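/- For $\beta\in(1,2)$ and finite binary words $x,y\in\{0,1\}^*$ write $x\sim_\beta y$ if $x$ and $y$ have the same length $n$ and $\sum_{i=1}^n x_i\beta^{-i}=\sum_{i=1}^n y_i\beta^{-i}$. Let $M_\beta:\{0,1\}^*\to\{0,1\}^*$ be the map that sends $x$ to the lexicographically largest element (with $0<1$) of its equivalence class $[x]_\beta=\{y : y\sim_\beta x\}$. Theorem. Let $\beta\in(1,2)$ be an algebraic number. Then $M_\beta$ is a computable function. Moreover, if $\beta$ is a Pisot number (an algebraic integer greater than $1$ all of whose other Galois conjugates have modulus strictly less than $1$), then $M_\beta$ is computable in linear time: there are a (multi-tape) Turing machine and a constant $C$, both depending only on $\beta$, such that on every input $x\in\{0,1\}^*$ the machine halts with output $M_\beta(x)$ after at most $C(|x|+1)$ steps. -/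

import Mathlib

noncomputable section

namespace BetaExpansion

/-- The value `∑_{i=1}^n x_i β^{-i}` of a finite binary word `x = x_1 ⋯ x_n` in base `β`
(letters are `false = 0` and `true = 1`; the list index starts at `0`). -/
def value (β : ℝ) (x : List Bool) : ℝ :=
  ∑ i : Fin x.length, (if x.get i = true then (1 : ℝ) else 0) * (β ^ ((i : ℕ) + 1))⁻¹

/-- `x ∼_β y`: the words have the same length and the same value in base `β`. -/
def Equivalent (β : ℝ) (x y : List Bool) : Prop :=
  x.length = y.length ∧ value β x = value β y

/-- The equivalence class `[x]_β`. -/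
def eqClass (β : ℝ) (x : List Bool) : Set (List Bool) :=
  {y | Equivalent β x y}

theorem eqClass_finite (β : ℝ) (x : List Bool) : (eqClass β x).Finite :=
  (List.finite_length_eq Bool x.length).subset fun _ hy => hy.1.symm

theorem self_mem_eqClass (β : ℝ) (x : List Bool) : x ∈ eqClass β x := ⟨rfl, rfl⟩

/-- The map `M_β`: the largest element of `[x]_β` for the lexicographic order, which is the
linear order of `List Bool` (with `false < true`). -/
def lexMaxRep (β : ℝ) (x : List Bool) : List Bool :=
  (eqClass_finite β x).toFinset.max'
    ⟨x, (eqClass_finite β x).mem_toFinset.2 (self_mem_eqClass β x)⟩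

/-- A Pisot number: a real algebraic integer greater than `1` all of whose other Galois
conjugates lie strictly inside the complex unit disk. -/
def IsPisot (β : ℝ) : Prop :=
  1 < β ∧ IsIntegral ℤ β ∧ ∀ z ∈ (minpoly ℚ β).rootSet ℂ, z ≠ (β : ℂ) → ‖z‖ < 1

/-- `f` is computed by a (multi-stack) Turing machine which, started on the letters of `x`,
outputs the letters of `f x` after at most `C * (|x| + 1)` steps, for a constant `C`. -/
def ComputableInLinearTime (f : List Bool → List Bool) : Prop :=
  ∃ (T : Turing.TM2ComputableInTime (id : List Bool → List Bool) (id : List Bool → List Bool) f)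
    (C : ℕ), ∀ n : ℕ, T.time n ≤ C * (n + 1)

end BetaExpansion

end

/-! Both halves rest on a finite test for equality of two expansions.

Pisot case: read `x` and `y` in parallel and keep the difference `s ↦ β s + (a - b)` in `ℚ(β)`; the
words are equivalent iff it ends at `0`. It stays an algebraic integer. At a conjugate inside the
unit disc it is bounded because the recursion contracts; at `β` itself it must be bounded, since an
expanding recursion never brings a large value back to `0`. So only finitely many states matter. A
right-to-left automaton then records from which states `0` is reachable on the remaining suffix, and
a left-to-right pass greedily outputs `1` whenever this keeps `0` reachable. Such a bimachine costs
a constant number of passes over stacks (`computableInLinearTime_eval`,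
`outputFrom_greedyBimachine`).

Algebraic case: let `m` be an integer polynomial of least degree killing `β`. Pseudo-division by `m`
turns equality at `β` into the vanishing of a remainder with explicitly bounded coefficients
(`exists_reduction`). Evaluated at a large integer `N`, this becomes divisibility by `m(N)`
(`eval_dvd_iff_horner_eq`), which is primitive recursive; a search through all words of the given
length finishes. -/

namespace BetaExpansion

/-! ### Bimachines and their realisation in linear time -/

/-- A sequential bimachine on binary words: a deterministic automaton with states `P` reads the
word from right to left, and a sequential transducer with states `Q` reads it from left to right;
the transducer sees, together with each letter, the state that the automaton has reached on the
remaining suffix. -/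
structure Bimachine (P Q : Type) where
  rightInit : P
  rightStep : P → Bool → P
  leftInit : Q
  leftStep : Q → Bool → P → Q
  output : Q → Bool → P → Bool

namespace Bimachine

variable {P Q : Type} (M : Bimachine P Q)

/-- The state of the right-to-left automaton after a suffix. -/
def right : List Bool → P
  | [] => M.rightInit
  | a :: l => M.rightStep (right l) a

/-- The output of the left-to-right transducer started in a given state. -/
def outputFrom : Q → List Bool → List Bool
  | _, [] => []
  | q, a :: l => M.output q a (M.right l) :: outputFrom (M.leftStep q a (M.right l)) l

/-- The function computed by a bimachine. -/
def eval (x : List Bool) : List Bool := M.outputFrom M.leftInit x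

/-- The word annotated with the states of the right-to-left automaton. -/
def annotate : List Bool → List (Bool × P)
  | [] => []
  | a :: l => (a, M.right l) :: annotate l

theorem length_outputFrom (q : Q) (x : List Bool) : (M.outputFrom q x).length = x.length := by
  induction x generalizing q with
  | nil => rfl
  | cons a l ih => simp [outputFrom, ih]

/-- The stack alphabets of the machine simulating a bimachine: the stack `some true` holds the
input and the output, `some false` reversed words, and `none` annotated words. -/
abbrev StackSymbol (P : Type) : Option Bool → Type
  | some _ => Bool
  | none => Bool × P

/-- The internal memory of the machine simulating a bimachine. -/
abbrev Memory (P Q : Type) : Type := Option (Bool × P) × P × Q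

variable [Fintype P] [Fintype Q]

open Turing.TM2.Stmt in
/-- A Turing machine simulating a bimachine: it reverses the input, annotates it from right to
left, translates the annotated word from left to right, and reverses the result. -/
abbrev machine : Turing.FinTM2 where
  K := Option Bool
  k₀ := some true
  k₁ := some true
  Γ := StackSymbol P
  Λ := Fin 4
  main := 0
  σ := Memory P Q
  initialState := (none, M.rightInit, M.leftInit)
  Γk₀Fin := inferInstanceAs (Fintype Bool)
  m := fun
    | 0 => pop (some true) (fun v a => (a.map fun a => (a, v.2.1), v.2))
        (branch (fun v => v.1.isSome)
          -- The default of `getD` is never used: the branch has just checked that a letter was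
          -- popped.
          (push (some false) (fun v => (v.1.getD (false, v.2.1)).1) (goto fun _ => 0))
          (goto fun _ => 1))
    | 1 => pop (some false) (fun v a => (a.map fun a => (a, v.2.1), v.2))
        (branch (fun v => v.1.isSome)
          (push none (fun v => v.1.getD (false, v.2.1))
            (load (fun v => (none, M.rightStep v.2.1 (v.1.getD (false, v.2.1)).1, v.2.2))
              (goto fun _ => 1)))
          (goto fun _ => 2))
    | 2 => pop none (fun v a => (a, v.2))
        (branch (fun v => v.1.isSome)
          (push (some false) (fun v => M.output v.2.2 (v.1.getD (false, v.2.1)).1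
              (v.1.getD (false, v.2.1)).2)
            (load (fun v => (none, v.2.1, M.leftStep v.2.2 (v.1.getD (false, v.2.1)).1
              (v.1.getD (false, v.2.1)).2))
              (goto fun _ => 2)))
          (goto fun _ => 3))
    | 3 => pop (some false) (fun v a => (a.map fun a => (a, v.2.1), v.2))
        (branch (fun v => v.1.isSome)
          (push (some true) (fun v => (v.1.getD (false, v.2.1)).1) (goto fun _ => 3))
          -- A halting configuration must carry the initial memory, so it is restored here.
          (load (fun _ => (none, M.rightInit, M.leftInit)) halt))

/-- The stacks of the machine with prescribed contents. -/
def contents (X A : List Bool) (B : List (Bool × P)) : ∀ k, List (StackSymbol P k)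
  | some true => X
  | some false => A
  | none => B

omit [Fintype P] in
@[simp] theorem update_contents_true (X A X' : List Bool) (B : List (Bool × P)) :
    Function.update (contents X A B) (some true) X' = contents X' A B := by
  funext k
  rcases k with _ | _ | _ <;> simp [contents, Function.update]

omit [Fintype P] in
@[simp] theorem update_contents_false (X A A' : List Bool) (B : List (Bool × P)) :
    Function.update (contents X A B) (some false) A' = contents X A' B := by
  funext k
  rcases k with _ | _ | _ <;> simp [contents, Function.update]

omit [Fintype P] in
@[simp] theorem update_contents_none (X A : List Bool) (B B' : List (Bool × P)) :
    Function.update (contents X A B) none B' = contents X A B' := by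
  funext k
  rcases k with _ | _ | _ <;> simp [contents, Function.update]

/-- The machine passes from the first configuration to the second in exactly `n` steps. -/
def StepsTo (n : ℕ) (c c' : M.machine.Cfg) : Prop :=
  (flip bind M.machine.step)^[n] (some c) = some c'

variable {M}

theorem StepsTo.trans {n n' : ℕ} {c c' c'' : M.machine.Cfg} (h : M.StepsTo n c c')
    (h' : M.StepsTo n' c' c'') : M.StepsTo (n' + n) c c'' := by
  rw [StepsTo, Function.iterate_add_apply, h, h']

theorem StepsTo.head {n : ℕ} {c c' c'' : M.machine.Cfg} (h : M.machine.step c = some c')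
    (h' : M.StepsTo n c' c'') : M.StepsTo (n + 1) c c'' :=
  StepsTo.trans (n := 1) h h'

theorem StepsTo.single {c c' : M.machine.Cfg} (h : M.machine.step c = some c') :
    M.StepsTo 1 c c' := h

variable (M)

/-- A configuration of the machine. -/
def config (l : Option (Fin 4)) (v : Memory P Q) (X A : List Bool) (B : List (Bool × P)) :
    M.machine.Cfg :=
  ⟨l, v, contents X A B⟩

theorem stepsTo_reverse (X A : List Bool) (s : Option (Bool × P)) (p : P) (q : Q) :
    M.StepsTo (X.length + 1) (M.config (some 0) (s, p, q) X A [])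
      (M.config (some 1) (none, p, q) [] (X.reverse ++ A) []) := by
  induction X generalizing A s with
  | nil => exact .single (by simp [config, Turing.TM2.step, contents]; rfl)
  | cons a X ih =>
    refine .head (c' := M.config (some 0) (some (a, p), p, q) X (a :: A) []) ?_ ?_
    · simp [config, Turing.TM2.step, contents]; rfl
    · simpa using ih (a :: A) _

/-- Invariant of the second pass: `A` is the unread prefix with its last letter on top, and `l` the
suffix already annotated. -/
theorem stepsTo_annotate (A l : List Bool) (s : Option (Bool × P)) (q : Q) :
    M.StepsTo (A.length + 1) (M.config (some 1) (s, M.right l, q) [] A (M.annotate l))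
      (M.config (some 2) (none, M.right (A.reverse ++ l), q) [] []
        (M.annotate (A.reverse ++ l))) := by
  induction A generalizing l s with
  | nil => exact .single (by simp [config, Turing.TM2.step, contents]; rfl)
  | cons a A ih =>
    refine .head (c' := M.config (some 1) (none, M.right (a :: l), q) [] A
      (M.annotate (a :: l))) ?_ ?_
    · simp [config, Turing.TM2.step, contents, right, annotate]; rfl
    · simpa using ih (a :: l) _

theorem stepsTo_translate (l A : List Bool) (s : Option (Bool × P)) (p : P) (q : Q) :
    ∃ q', M.StepsTo (l.length + 1) (M.config (some 2) (s, p, q) [] A (M.annotate l))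
      (M.config (some 3) (none, p, q') [] ((M.outputFrom q l).reverse ++ A) []) := by
  induction l generalizing A s q with
  | nil => exact ⟨q, .single (by simp [config, Turing.TM2.step, contents, annotate, outputFrom]; rfl)⟩
  | cons a l ih =>
    obtain ⟨q', h⟩ := ih (M.output q a (M.right l) :: A) none (M.leftStep q a (M.right l))
    refine ⟨q', .head (c' := M.config (some 2) (none, p, M.leftStep q a (M.right l)) []
      (M.output q a (M.right l) :: A) (M.annotate l)) ?_ ?_⟩
    · simp [config, Turing.TM2.step, contents, annotate]; rfl
    · simpa [outputFrom] using h

theorem stepsTo_reverse_back (A X : List Bool) (s : Option (Bool × P)) (p : P) (q : Q) :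
    M.StepsTo (A.length + 1) (M.config (some 3) (s, p, q) X A [])
      (M.config none (none, M.rightInit, M.leftInit) (A.reverse ++ X) [] []) := by
  induction A generalizing X s with
  | nil => exact .single (by simp [config, Turing.TM2.step, contents]; rfl)
  | cons a A ih =>
    refine .head (c' := M.config (some 3) (some (a, p), p, q) (a :: X) A []) ?_ ?_
    · simp [config, Turing.TM2.step, contents]; rfl
    · simpa using ih (a :: X) _

/-- Each of the four passes costs one step per letter and one more to notice the empty stack. -/
theorem stepsTo_eval (x : List Bool) :
    M.StepsTo (4 * (x.length + 1))
      (M.config (some 0) (none, M.rightInit, M.leftInit) x [] [])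
      (M.config none (none, M.rightInit, M.leftInit) (M.eval x) [] []) := by
  have h₁ := M.stepsTo_reverse x [] none M.rightInit M.leftInit
  have h₂ := M.stepsTo_annotate x.reverse [] none M.leftInit
  obtain ⟨q, h₃⟩ := M.stepsTo_translate x [] none (M.right x) M.leftInit
  have h₄ := M.stepsTo_reverse_back (M.eval x).reverse [] none (M.right x) q
  simp only [List.append_nil, List.reverse_reverse, List.length_reverse] at h₁ h₂ h₃ h₄
  rw [eval, length_outputFrom] at h₄
  rw [eval]
  convert ((h₁.trans h₂).trans h₃).trans h₄ using 1
  ring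

theorem initList_machine (x : List Bool) : Turing.initList M.machine x =
    M.config (some 0) (none, M.rightInit, M.leftInit) x [] [] := by
  rw [Turing.initList, config]
  congr 1
  funext k
  rcases k with _ | _ | _ <;> simp [contents]

theorem haltList_machine (x : List Bool) : Turing.haltList M.machine x =
    M.config none (none, M.rightInit, M.leftInit) x [] [] := by
  rw [Turing.haltList, config]
  congr 1
  funext k
  rcases k with _ | _ | _ <;> simp [contents]

theorem computableInLinearTime_eval : ComputableInLinearTime M.eval := by
  refine ⟨{ tm := M.machine
            inputAlphabet := Equiv.refl Bool
            outputAlphabet := Equiv.refl Bool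
            time := fun n => 4 * (n + 1)
            outputsFun := fun x => ⟨⟨4 * (x.length + 1), ?_⟩, le_rfl⟩ }, 4, fun n => le_rfl⟩
  change M.StepsTo _ (Turing.initList M.machine (List.map id x))
    (Turing.haltList M.machine (List.map id (M.eval x)))
  rw [List.map_id, List.map_id, initList_machine, haltList_machine]
  exact M.stepsTo_eval x

end Bimachine

/-! ### The lexicographically largest representation -/

theorem eq_lexMaxRep {β : ℝ} {x y : List Bool} (hy : y ∈ eqClass β x)
    (hmax : ∀ z ∈ eqClass β x, z ≤ y) : lexMaxRep β x = y :=
  le_antisymm (hmax _ ((eqClass_finite β x).mem_toFinset.1 (Finset.max'_mem _ _)))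
    (Finset.le_max' _ _ ((eqClass_finite β x).mem_toFinset.2 hy))

theorem cons_le_cons_of {a b : Bool} {l l' : List Bool} (h : a < b ∨ a = b ∧ l ≤ l') :
    a :: l ≤ b :: l' := by
  rcases h with h | ⟨rfl, h⟩
  · exact le_of_lt (List.cons_lt_cons_iff.2 (.inl h))
  · exact List.cons_le_cons a h

/-- A letter as an element of a ring. -/
def digit (R : Type*) [Zero R] [One R] (b : Bool) : R := if b then 1 else 0

theorem map_digit {R S F : Type*} [NonAssocSemiring R] [NonAssocSemiring S] [FunLike F R S]
    [RingHomClass F R S] (f : F) (b : Bool) : f (digit R b) = digit S b := by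
  cases b <;> simp [digit]

theorem value_nil (β : ℝ) : value β [] = 0 := by simp [value]

theorem value_cons (β : ℝ) (a : Bool) (l : List Bool) :
    value β (a :: l) = (digit ℝ a + value β l) * β⁻¹ := by
  simp only [value]
  refine (Fin.sum_univ_succ (n := l.length) _).trans ?_
  rw [add_mul, Finset.sum_mul]
  congr 1
  · cases a <;> simp [digit]
  · refine Finset.sum_congr rfl fun i _ => ?_
    rw [Fin.val_succ, pow_succ β (i + 1), mul_inv, mul_assoc]
    rfl

/-! ### Greedy bimachines -/

section Greedy

variable {A : Type} (step : A → Bool → Bool → A)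

/-- The state reached by a transition system reading a pair of words. -/
def run (s : A) : List Bool → List Bool → A
  | a :: l, b :: y => run (step s a b) l y
  | _, _ => s

open Classical in
/-- The bimachine which, reading `x`, outputs the largest word `y` for which `(x, y)` labels a path
from `s₀` to `z` in the part `S` of a transition system. -/
noncomputable def greedyBimachine (S : Set A) (s₀ : S) (z : A) : Bimachine (Set S) S where
  rightInit := {s | s.1 = z}
  rightStep R a := {s | ∃ b, ∃ t ∈ R, t.1 = step s a b}
  leftInit := s₀
  leftStep q a R :=
    -- The fallback `q` is junk: it never occurs along a run whose current state can still reach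
    -- `z`.
    if h : step q a (decide (∃ t ∈ R, t.1 = step q a true)) ∈ S then ⟨_, h⟩ else q
  output q a R := decide (∃ t ∈ R, t.1 = step q a true)

variable {step} {S : Set A} {z : A} (s₀ : S)

/-- The hypothesis `hS` says that a step out of `S` can no longer lead to `z`, so restricting the
states to `S` loses no accepted pair. -/
theorem mem_right_greedyBimachine
    (hS : ∀ s ∈ S, ∀ (a b : Bool) (l y : List Bool), y.length = l.length →
      run step (step s a b) l y = z → step s a b ∈ S) (l : List Bool) (s : S) :
    s ∈ (greedyBimachine step S s₀ z).right l ↔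
      ∃ y : List Bool, y.length = l.length ∧ run step s l y = z := by
  induction l generalizing s with
  | nil => simp [Bimachine.right, greedyBimachine, run]
  | cons a l ih =>
    change (∃ b, ∃ t ∈ (greedyBimachine step S s₀ z).right l, t.1 = step s a b) ↔ _
    constructor
    · rintro ⟨b, t, ht, h⟩
      obtain ⟨y, hy, hr⟩ := (ih t).1 ht
      exact ⟨b :: y, by simp [hy], by rw [run, ← h, hr]⟩
    · rintro ⟨_ | ⟨b, y⟩, hy, hr⟩
      · simp at hy
      · have hy' : y.length = l.length := by simpa using hy
        rw [run] at hr
        exact ⟨b, ⟨_, hS s s.2 a b l y hy' hr⟩, (ih _).2 ⟨y, hy', hr⟩, rfl⟩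

theorem outputFrom_greedyBimachine
    (hS : ∀ s ∈ S, ∀ (a b : Bool) (l y : List Bool), y.length = l.length →
      run step (step s a b) l y = z → step s a b ∈ S) (l : List Bool) (s : S)
    (hs : s ∈ (greedyBimachine step S s₀ z).right l) :
    run step s l ((greedyBimachine step S s₀ z).outputFrom s l) = z ∧
      ∀ y : List Bool, y.length = l.length → run step s l y = z →
        y ≤ (greedyBimachine step S s₀ z).outputFrom s l := by
  classical
  induction l generalizing s with
  | nil =>
    refine ⟨by simpa [Bimachine.right, greedyBimachine, run] using hs, fun y hy _ => ?_⟩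
    rw [List.length_eq_zero_iff.1 hy, Bimachine.outputFrom]
  | cons a l ih =>
    set M := greedyBimachine step S s₀ z with hM
    set b := M.output s a (M.right l) with hb
    have hbd : b = decide (∃ t ∈ M.right l, t.1 = step s a true) := rfl
    have key : ∃ t ∈ M.right l, t.1 = step s a b := by
      by_cases h : ∃ t ∈ M.right l, t.1 = step s a true
      · rwa [hbd, decide_eq_true h]
      · obtain ⟨c, hc⟩ : ∃ c, ∃ t ∈ M.right l, t.1 = step s a c := hs
        cases c
        · rwa [hbd, decide_eq_false h]
        · exact absurd hc h
    obtain ⟨t, ht, hts⟩ := key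
    have hstep : M.leftStep s a (M.right l) = t := by
      have hmem : step s a b ∈ S := hts ▸ t.2
      change (if h : step s a b ∈ S then (⟨_, h⟩ : S) else s) = t
      rw [dif_pos hmem]
      exact Subtype.ext hts.symm
    obtain ⟨h₁, h₂⟩ := ih t ht
    rw [Bimachine.outputFrom, hstep, ← hb]
    refine ⟨by rw [run, ← hts, h₁], ?_⟩
    rintro (_ | ⟨c, y⟩) hy hr
    · simp at hy
    have hy' : y.length = l.length := by simpa using hy
    rw [run] at hr
    rcases eq_or_ne c b with rfl | hcb
    · rw [← hts] at hr
      exact cons_le_cons_of (.inr ⟨rfl, h₂ y hy' hr⟩)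
    · refine cons_le_cons_of (.inl ?_)
      cases c
      · exact Bool.lt_iff.2 ⟨rfl, by simpa using hcb.symm⟩
      · have : ∃ t ∈ M.right l, t.1 = step s a true :=
          ⟨⟨_, hS s s.2 a true l y hy' hr⟩,
            (mem_right_greedyBimachine s₀ hS l _).2 ⟨y, hy', hr⟩, rfl⟩
        exact absurd (by rw [hbd, decide_eq_true this]) hcb

end Greedy

/-! ### Pisot numbers -/

section Pisot

variable {K : Type} [Field K]

/-- Reading a pair of letters appends their difference to an expansion in base `g`. -/
def differenceStep (g : K) (s : K) (a b : Bool) : K := g * s + (digit K a - digit K b)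

theorem run_differenceStep [Algebra K ℝ] (g s : K) (hg : algebraMap K ℝ g ≠ 0) (x y : List Bool)
    (h : y.length = x.length) :
    algebraMap K ℝ (run (differenceStep g) s x y) = algebraMap K ℝ g ^ x.length *
      (algebraMap K ℝ s + value (algebraMap K ℝ g) x - value (algebraMap K ℝ g) y) := by
  induction x generalizing s y with
  | nil =>
    rw [List.length_eq_zero_iff.1 h]
    simp [run]
  | cons a x ih =>
    rcases y with _ | ⟨b, y⟩
    · simp at h
    rw [run, ih _ y (by simpa using h), value_cons, value_cons, differenceStep]
    simp only [map_add, map_sub, map_mul, map_digit, List.length_cons]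
    field_simp
    ring

theorem norm_digit_sub_le (a b : Bool) : ‖digit ℂ a - digit ℂ b‖ ≤ 1 := by
  cases a <;> cases b <;> simp [digit]

/-- With `ρ = ‖φ g‖ < 1`, the disc of radius `B ≥ 1 / (1 - ρ)` is invariant because `ρ B + 1 ≤ B`.
-/
theorem norm_differenceStep_le {g s : K} (φ : K →+* ℂ) (hφ : ‖φ g‖ < 1) {B : ℝ}
    (hB : |1 / (1 - ‖φ g‖)| ≤ B) (hs : ‖φ s‖ ≤ B) (a b : Bool) :
    ‖φ (differenceStep g s a b)‖ ≤ B := by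
  have h0 : 0 < 1 - ‖φ g‖ := sub_pos.2 hφ
  have hB' := (div_le_iff₀ h0).1 ((le_abs_self _).trans hB)
  have h1 := norm_add_le (φ g * φ s) (digit ℂ a - digit ℂ b)
  have h2 := norm_digit_sub_le a b
  rw [norm_mul] at h1
  have h3 := mul_le_mul_of_nonneg_left hs (norm_nonneg (φ g))
  simp only [differenceStep, map_add, map_sub, map_mul, map_digit]
  linarith

/-- Backwards from `0`: with `ρ = ‖φ g‖ > 1`, a state followed by one of size at most `B` has size
at most `(B + 1) / ρ ≤ B`. The absolute value in `hB` lets one bound serve this case and the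
contracting one. -/
theorem norm_le_of_run_eq_zero {g s : K} (φ : K →+* ℂ) (hφ : 1 < ‖φ g‖) {B : ℝ}
    (hB : |1 / (1 - ‖φ g‖)| ≤ B) (x y : List Bool) (h : y.length = x.length)
    (h0 : run (differenceStep g) s x y = 0) : ‖φ s‖ ≤ B := by
  induction x generalizing s y with
  | nil =>
    rw [List.length_eq_zero_iff.1 h] at h0
    rw [show s = 0 from h0, map_zero, norm_zero]
    exact (abs_nonneg _).trans hB
  | cons a x ih =>
    rcases y with _ | ⟨b, y⟩
    · simp at h
    have ih' := ih y (by simpa using h) h0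
    have hpos : 0 < ‖φ g‖ - 1 := sub_pos.2 hφ
    have hB' : 1 / (‖φ g‖ - 1) ≤ B := by
      refine le_trans ?_ hB
      rw [abs_div, abs_one, abs_sub_comm, abs_of_pos hpos]
    rw [div_le_iff₀ hpos] at hB'
    have h1 : φ g * φ s = φ (differenceStep g s a b) - (digit ℂ a - digit ℂ b) := by
      simp [differenceStep, map_digit]
    have h2 := norm_sub_le (φ (differenceStep g s a b)) (digit ℂ a - digit ℂ b)
    have h3 := norm_digit_sub_le a b
    rw [← h1, norm_mul] at h2
    by_contra! hlt
    nlinarith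

theorem computableInLinearTime_lexMaxRep {β : ℝ} (hβ : IsPisot β) :
    ComputableInLinearTime (lexMaxRep β) := by
  obtain ⟨hβ1, hint, hconj⟩ := hβ
  have hβ0 : β ≠ 0 := by positivity
  have hintQ : IsIntegral ℚ β := hint.tower_top
  let K := IntermediateField.adjoin ℚ {β}
  have : FiniteDimensional ℚ K := IntermediateField.adjoin.finiteDimensional hintQ
  have : NumberField K := { to_charZero := inferInstance, to_finiteDimensional := this }
  let g : K := IntermediateField.AdjoinSimple.gen ℚ β
  have hgβ : algebraMap K ℝ g = β := IntermediateField.AdjoinSimple.algebraMap_gen ℚ β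
  have hg : IsIntegral ℤ g := by
    rw [← isIntegral_algebraMap_iff (FaithfulSMul.algebraMap_injective K ℝ), hgβ]
    exact hint
  have hφ (φ : K →+* ℂ) : φ g = β ∨ ‖φ g‖ < 1 := by
    rw [or_iff_not_imp_left]
    refine hconj _ ?_
    have h0 : Polynomial.aeval g (minpoly ℚ β) = 0 := by
      rw [← hgβ, minpoly.algebraMap_eq (FaithfulSMul.algebraMap_injective K ℝ), minpoly.aeval]
    rw [Polynomial.mem_rootSet]
    refine ⟨minpoly.ne_zero hintQ, ?_⟩
    have := congrArg φ.toRatAlgHom h0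
    rwa [map_zero, ← Polynomial.aeval_algHom_apply] at this
  -- No embedding puts `g` on the unit circle, so each one is either expanding or contracting.
  have hφ' (φ : K →+* ℂ) : 1 < ‖φ g‖ ∨ ‖φ g‖ < 1 := by
    refine (hφ φ).imp_left fun h => ?_
    rw [h, Complex.norm_real, Real.norm_eq_abs]
    exact hβ1.trans_le (le_abs_self β)
  -- Summing over the embeddings gives one radius valid for all of them.
  set B : ℝ := ∑ φ : K →+* ℂ, |1 / (1 - ‖φ g‖)|
  have hB (φ : K →+* ℂ) : |1 / (1 - ‖φ g‖)| ≤ B :=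
    Finset.single_le_sum (f := fun φ : K →+* ℂ => |1 / (1 - ‖φ g‖)|)
      (fun _ _ => abs_nonneg _) (Finset.mem_univ φ)
  set S : Set K := {s | IsIntegral ℤ s ∧ ∀ φ : K →+* ℂ, ‖φ s‖ ≤ B}
  -- Only finitely many algebraic integers of a number field have all their conjugates bounded by
  -- `B`.
  have hfin : Finite S := NumberField.Embeddings.finite_of_norm_le K ℂ B
  have hS : ∀ s ∈ S, ∀ (a b : Bool) (l y : List Bool), y.length = l.length →
      run (differenceStep g) (differenceStep g s a b) l y = 0 → differenceStep g s a b ∈ S := by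
    intro s hs a b l y hl hr
    have hd (c : Bool) : IsIntegral ℤ (digit K c) := by
      cases c
      · exact isIntegral_zero
      · exact isIntegral_one
    refine ⟨(hg.mul hs.1).add ((hd a).sub (hd b)), fun φ => ?_⟩
    rcases hφ' φ with h | h
    · exact norm_le_of_run_eq_zero φ h (hB φ) l y hl hr
    · exact norm_differenceStep_le φ h (hB φ) (hs.2 φ) a b
  have hmem (x y : List Bool) (h : y.length = x.length) :
      run (differenceStep g) 0 x y = 0 ↔ y ∈ eqClass β x := by
    rw [← (algebraMap K ℝ).injective.eq_iff, run_differenceStep g 0 (by rwa [hgβ]) x y h, hgβ]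
    simp [eqClass, Equivalent, h, hβ0, sub_eq_zero]
  let s₀ : S := ⟨0, isIntegral_zero, fun φ => by
    rw [map_zero, norm_zero]
    exact (abs_nonneg _).trans (hB φ)⟩
  have := Fintype.ofFinite S
  have := Fintype.ofFinite (Set S)
  suffices h : lexMaxRep β = (greedyBimachine (differenceStep g) S s₀ 0).eval by
    rw [h]
    exact Bimachine.computableInLinearTime_eval _
  funext x
  have hx := (mem_right_greedyBimachine s₀ hS x s₀).2
    ⟨x, rfl, (hmem x x rfl).2 (self_mem_eqClass β x)⟩
  obtain ⟨h₁, h₂⟩ := outputFrom_greedyBimachine s₀ hS x s₀ hx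
  exact eq_lexMaxRep ((hmem x _ (Bimachine.length_outputFrom ..)).1 h₁)
    fun z hz => h₂ z hz.1.symm ((hmem x z hz.1.symm).2 hz)

end Pisot

open Polynomial

/-! ### Expansions as polynomials -/

/-- The number with a given binary word as its expansion in base `t`. -/
def horner {R : Type*} [Semiring R] (t : R) (l : List Bool) : R :=
  l.foldl (fun s b => s * t + digit R b) 0

theorem map_horner {R S : Type*} [Semiring R] [Semiring S] (f : R →+* S) (t : R) (l : List Bool) :
    f (horner t l) = horner (f t) l := by
  induction l using List.reverseRecOn with
  | nil => simp [horner]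
  | append_singleton l b ih => simp_all [horner, map_digit]

theorem horner_concat {R : Type*} [Semiring R] (t : R) (l : List Bool) (b : Bool) :
    horner t (l ++ [b]) = horner t l * t + digit R b := by
  simp [horner]

theorem foldl_eq_pow_mul_value {β : ℝ} (hβ : β ≠ 0) (l : List Bool) (s : ℝ) :
    l.foldl (fun s b => s * β + digit ℝ b) s = β ^ l.length * (s + value β l) := by
  induction l generalizing s with
  | nil => simp [value_nil]
  | cons a l ih =>
    rw [List.foldl_cons, ih, value_cons, List.length_cons]
    field_simp
    ring

theorem horner_eq_pow_mul_value {β : ℝ} (hβ : β ≠ 0) (l : List Bool) :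
    horner β l = β ^ l.length * value β l := by
  rw [horner, foldl_eq_pow_mul_value hβ, zero_add]

/-! ### Evaluating integer polynomials at large integers -/

/-- Digits of size at most `N - 1` in base `N` sum to at most `N ^ k - 1`, a geometric series. -/
theorem abs_sum_mul_pow_lt (f : ℕ → ℤ) {N : ℤ} (hf : ∀ i, |f i| < N) (k : ℕ) :
    |∑ i ∈ Finset.range k, f i * N ^ i| < N ^ k := by
  have hN : 0 < N := (abs_nonneg _).trans_lt (hf 0)
  induction k with
  | zero => simp
  | succ k ih =>
    rw [Finset.sum_range_succ]
    have h₁ := abs_add_le (∑ i ∈ Finset.range k, f i * N ^ i) (f k * N ^ k)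
    have h₂ : |f k * N ^ k| ≤ (N - 1) * N ^ k := by
      rw [abs_mul, abs_of_pos (pow_pos hN k)]
      exact mul_le_mul_of_nonneg_right (Int.le_sub_one_of_lt (hf k)) (pow_pos hN k).le
    rw [pow_succ]
    linarith

theorem eval_pos_of_abs_coeff_lt {p : ℤ[X]} {N : ℤ} (hp : 0 < p.leadingCoeff)
    (hN : ∀ i, |p.coeff i| < N) : 0 < p.eval N := by
  have h0 : 0 < N := (abs_nonneg _).trans_lt (hN 0)
  rw [eval_eq_sum_range, Finset.sum_range_succ]
  have h₁ := (abs_lt.1 (abs_sum_mul_pow_lt _ hN p.natDegree)).1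
  have h₂ : 1 * N ^ p.natDegree ≤ p.coeff p.natDegree * N ^ p.natDegree :=
    mul_le_mul_of_nonneg_right hp (pow_pos h0 _).le
  linarith

theorem eq_zero_of_eval_eq_zero {p : ℤ[X]} {N : ℤ} (hN : ∀ i, |p.coeff i| < N)
    (h : p.eval N = 0) : p = 0 := by
  by_contra h0
  rcases lt_or_gt_of_ne (leadingCoeff_ne_zero.2 h0) with hl | hl
  · have := eval_pos_of_abs_coeff_lt (p := -p) (N := N) (by simpa using hl) (by simpa using hN)
    simp [h] at this
  · exact (eval_pos_of_abs_coeff_lt hl hN).ne' h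

/-- Both `m + r` and `m - r` inherit the leading coefficient of `m` and have coefficients below `N`,
so they are positive at `N`. Hence `|r(N)| < m(N)`, divisibility forces `r(N) = 0`, and small
coefficients force `r = 0`. -/
theorem eq_zero_of_eval_dvd_eval {m r : ℤ[X]} {H M N : ℤ} (hm : 0 < m.leadingCoeff)
    (hH : ∀ i, |m.coeff i| ≤ H) (hM : ∀ i, |r.coeff i| ≤ M) (hN : H + M < N)
    (hdeg : r.degree < m.degree) (h : m.eval N ∣ r.eval N) : r = 0 := by
  have hH0 : 0 ≤ H := (abs_nonneg _).trans (hH 0)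
  refine eq_zero_of_eval_eq_zero (fun i => (hM i).trans_lt (by linarith)) ?_
  refine Int.eq_zero_of_abs_lt_dvd h (abs_lt.2 ⟨?_, ?_⟩)
  · have := eval_pos_of_abs_coeff_lt (p := m + r) (N := N)
      (by rwa [leadingCoeff_add_of_degree_lt' hdeg]) fun i => by
        have := abs_add_le (m.coeff i) (r.coeff i)
        rw [coeff_add]
        linarith [hH i, hM i]
    rw [eval_add] at this
    linarith
  · have := eval_pos_of_abs_coeff_lt (p := m - r) (N := N)
      (by rwa [leadingCoeff_sub_of_degree_lt hdeg]) fun i => by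
        have := abs_sub (m.coeff i) (r.coeff i)
        rw [coeff_sub]
        linarith [hH i, hM i]
    rw [eval_sub] at this
    linarith

/-! ### Testing equality of expansions -/

theorem exists_abs_coeff_le (m : ℤ[X]) : ∃ H : ℕ, ∀ i, |m.coeff i| ≤ H := by
  refine ⟨∑ i ∈ m.support, (m.coeff i).natAbs, fun i => ?_⟩
  rw [Int.abs_eq_natAbs]
  by_cases hi : i ∈ m.support
  · exact_mod_cast Finset.single_le_sum (f := fun i => (m.coeff i).natAbs)
      (fun _ _ => Nat.zero_le _) hi
  · rw [notMem_support_iff.1 hi]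
    exact_mod_cast Nat.zero_le _

/-- Pseudo-division one letter at a time: since `m` need not be monic, each letter costs one factor
of its leading coefficient. The new remainder has three terms, each at most `H` times the old bound,
whence the factor `3 * H`. -/
theorem exists_reduction {m : ℤ[X]} (hdeg : 0 < m.natDegree) (hm : 0 < m.leadingCoeff) {H : ℕ}
    (hH : ∀ i, |m.coeff i| ≤ H) (l : List Bool) :
    ∃ q r : ℤ[X], C (m.leadingCoeff ^ l.length) * horner X l = m * q + r ∧
      r.degree < m.degree ∧ ∀ i, |r.coeff i| ≤ (3 * H) ^ l.length := by
  have hm0 : m ≠ 0 := by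
    rintro rfl
    simp at hm
  induction l using List.reverseRecOn with
  | nil => exact ⟨0, 0, by simp [horner], by simpa [bot_lt_iff_ne_bot] using hm0, by simp⟩
  | append_singleton l b ih =>
    obtain ⟨q, r, h, hr, hB⟩ := ih
    set a := m.leadingCoeff with ha
    set n := l.length
    have haH : a ≤ H := (le_abs_self _).trans (hH m.natDegree)
    obtain ⟨d, hd⟩ : ∃ d, m.natDegree = d + 1 := ⟨m.natDegree - 1, by omega⟩
    have had : m.coeff (d + 1) = a := by rw [← hd]; rfl
    rw [degree_eq_natDegree hm0, hd] at hr ⊢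
    rw [degree_lt_iff_coeff_zero] at hr
    have hdig : |digit ℤ b| ≤ 1 := by cases b <;> simp [digit]
    -- The polynomial `a X r` may reach degree `d + 1` with top coefficient `a * r.coeff d`;
    -- subtracting `r.coeff d` times `m` cancels it.
    refine ⟨C a * X * q + C (r.coeff d),
      C a * (r * X) + C (a ^ (n + 1) * digit ℤ b) - C (r.coeff d) * m, ?_, ?_, ?_⟩
    · have hdC : digit ℤ[X] b = C (digit ℤ b) := (map_digit C b).symm
      rw [horner_concat, List.length_append, List.length_singleton, hdC]
      simp only [map_mul, map_pow] at h ⊢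
      linear_combination (C a * X) * h
    · rw [degree_lt_iff_coeff_zero]
      intro i hi
      obtain ⟨j, rfl⟩ : ∃ j, i = j + 1 := ⟨i - 1, by omega⟩
      rw [coeff_sub, coeff_add, coeff_C_mul, coeff_C_mul, coeff_mul_X, coeff_C_succ]
      rcases eq_or_ne j d with rfl | hj
      · rw [had]
        ring
      · rw [hr j (by omega), coeff_eq_zero_of_natDegree_lt (p := m) (by omega)]
        ring
    · intro i
      have h₁ : |(C a * (r * X)).coeff i| ≤ (H * (3 * H) ^ n : ℤ) := by
        rw [coeff_C_mul, abs_mul, abs_of_pos hm]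
        refine mul_le_mul haH ?_ (abs_nonneg _) (by positivity)
        rcases i with _ | i
        · simp
        · rw [coeff_mul_X]
          exact hB i
      have h₂ : |(C (a ^ (n + 1) * digit ℤ b)).coeff i| ≤ H * (3 * H) ^ n := by
        have h3 : a ^ (n + 1) ≤ H * (3 * H) ^ n := by
          rw [pow_succ']
          exact mul_le_mul haH (pow_le_pow_left₀ hm.le (by linarith) n) (pow_pos hm n).le
            (by positivity)
        rw [coeff_C]
        split_ifs
        · rw [abs_mul, abs_of_pos (pow_pos hm _)]
          exact (mul_le_of_le_one_right (pow_pos hm _).le hdig).trans h3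
        · rw [abs_zero]
          positivity
      have h₃ : |(C (r.coeff d) * m).coeff i| ≤ H * (3 * H) ^ n := by
        rw [coeff_C_mul, abs_mul, mul_comm]
        exact mul_le_mul (hH i) (hB d) (abs_nonneg _) (by positivity)
      rw [coeff_sub, coeff_add, List.length_append, List.length_singleton, pow_succ (3 * (H : ℤ))]
      have h₄ := abs_sub ((C a * (r * X)).coeff i + (C (a ^ (n + 1) * digit ℤ b)).coeff i)
        ((C (r.coeff d) * m).coeff i)
      have h₅ := abs_add_le ((C a * (r * X)).coeff i) ((C (a ^ (n + 1) * digit ℤ b)).coeff i)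
      linarith

theorem exists_minimal_annihilator {β : ℝ} (h : IsAlgebraic ℤ β) :
    ∃ m : ℤ[X], 0 < m.natDegree ∧ 0 < m.leadingCoeff ∧ aeval β m = 0 ∧
      ∀ r : ℤ[X], r.degree < m.degree → aeval β r = 0 → r = 0 := by
  classical
  have hex : ∃ n, ∃ m : ℤ[X], m ≠ 0 ∧ aeval β m = 0 ∧ m.natDegree = n :=
    let ⟨m, hm, hm'⟩ := h
    ⟨_, m, hm, hm', rfl⟩
  obtain ⟨m, hm, hmβ, hn⟩ := Nat.find_spec hex
  have hmin (r : ℤ[X]) (hr : r.degree < m.degree) (hrβ : aeval β r = 0) : r = 0 := by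
    by_contra h0
    exact Nat.find_min hex (hn ▸ natDegree_lt_natDegree h0 hr) ⟨r, h0, hrβ, rfl⟩
  have hdeg : 0 < m.natDegree := by
    by_contra! h0
    rw [Nat.le_zero] at h0
    rw [eq_C_of_natDegree_eq_zero h0] at hmβ hm
    simp_all
  rcases lt_or_gt_of_ne (leadingCoeff_ne_zero.2 hm) with hl | hl
  · exact ⟨-m, by simpa, by simpa, by simpa, by simpa using hmin⟩
  · exact ⟨m, hdeg, hl, hmβ, hmin⟩

/-- Both sides say that the difference of the two remainders is zero: at `β` by minimality of `m`,
at `N` because the remainders are small. -/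
theorem eval_dvd_iff_horner_eq {β : ℝ} {m : ℤ[X]} (hdeg : 0 < m.natDegree)
    (hm : 0 < m.leadingCoeff) (hmβ : aeval β m = 0)
    (hmin : ∀ r : ℤ[X], r.degree < m.degree → aeval β r = 0 → r = 0) {H : ℕ}
    (hH : ∀ i, |m.coeff i| ≤ H) {x y : List Bool} (h : y.length = x.length) {N : ℤ}
    (hN : H + 2 * (3 * H) ^ x.length < N) :
    m.eval N ∣ m.leadingCoeff ^ x.length * (horner N x - horner N y) ↔
      horner β x = horner β y := by
  obtain ⟨q, r, hx, hr, hB⟩ := exists_reduction hdeg hm hH x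
  obtain ⟨q', r', hy, hr', hB'⟩ := exists_reduction hdeg hm hH y
  rw [h] at hy hB'
  have hxy : C (m.leadingCoeff ^ x.length) * (horner X x - horner X y) =
      m * (q - q') + (r - r') := by
    linear_combination hx - hy
  have hrr : (r - r').degree < m.degree := (degree_sub_le _ _).trans_lt (max_lt hr hr')
  have hev : m.leadingCoeff ^ x.length * (horner N x - horner N y) =
      m.eval N * (q - q').eval N + (r - r').eval N := by
    have := congrArg (evalRingHom N) hxy
    simpa only [map_mul, map_sub, map_add, map_horner, coe_evalRingHom, eval_X, eval_C, eval_sub]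
      using this
  have hae : (m.leadingCoeff : ℝ) ^ x.length * (horner β x - horner β y) = aeval β (r - r') := by
    have := congrArg (aeval β).toRingHom hxy
    simp only [map_mul, map_sub, map_add, map_horner, AlgHom.toRingHom_eq_coe, RingHom.coe_coe,
      hmβ, aeval_X, aeval_C, zero_mul, zero_add] at this
    simpa using this
  have ha : (m.leadingCoeff : ℝ) ^ x.length ≠ 0 := pow_ne_zero _ (by exact_mod_cast hm.ne')
  rw [← sub_eq_zero (a := horner β x), hev, dvd_add_right (dvd_mul_right _ _)]
  constructor
  · intro hd
    have h0 := eq_zero_of_eval_dvd_eval hm hH (M := 2 * (3 * H) ^ x.length) (fun i => by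
      have := abs_sub (r.coeff i) (r'.coeff i)
      rw [coeff_sub]
      linarith [hB i, hB' i]) hN hrr hd
    rw [h0, map_zero] at hae
    exact (mul_eq_zero.1 hae).resolve_left ha
  · intro h0
    rw [h0, mul_zero] at hae
    rw [hmin _ hrr hae.symm, eval_zero]
    exact dvd_zero _

/-! ### Computability for algebraic bases -/

theorem primrec_pow : Primrec₂ ((· ^ ·) : ℕ → ℕ → ℕ) :=
  Primrec₂.unpaired'.1 Nat.Primrec.pow

/-- Primitive recursion runs over `ℕ`, so positive and negative coefficients are separated. -/
theorem primrec_eval_sub (p : ℤ[X]) : ∃ f g : ℕ → ℕ, Primrec f ∧ Primrec g ∧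
    ∀ N : ℕ, p.eval (N : ℤ) = f N - g N := by
  induction p using Polynomial.induction_on' with
  | add p q hp hq =>
    obtain ⟨f, g, hf, hg, h⟩ := hp
    obtain ⟨f', g', hf', hg', h'⟩ := hq
    refine ⟨_, _, Primrec.nat_add.comp hf hf', Primrec.nat_add.comp hg hg', fun N => ?_⟩
    rw [eval_add, h, h']
    push_cast
    ring
  | monomial n c =>
    have hpow (k : ℕ) : Primrec fun N : ℕ => k * N ^ n :=
      Primrec.nat_mul.comp (.const k) (primrec_pow.comp .id (.const n))
    refine ⟨_, _, hpow c.toNat, hpow (-c).toNat, fun N => ?_⟩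
    have := Int.toNat_sub_toNat_neg c
    rw [eval_monomial]
    push_cast
    rw [← sub_mul, this]

theorem primrec_natAbs_eval (p : ℤ[X]) : Primrec fun N : ℕ => (p.eval (N : ℤ)).natAbs := by
  obtain ⟨f, g, hf, hg, h⟩ := primrec_eval_sub p
  -- With truncated subtraction, `|f - g| = (f - g) + (g - f)`.
  refine (Primrec.nat_add.comp (Primrec.nat_sub.comp hf hg) (Primrec.nat_sub.comp hg hf)).of_eq
    fun N => ?_
  rw [h]
  omega

theorem primrec_horner : Primrec₂ (horner : ℕ → List Bool → ℕ) := by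
  refine Primrec.list_foldl (h := fun p q => q.1 * p.1 + digit ℕ q.2) Primrec.snd (.const 0) ?_
  have hdigit : Primrec (digit ℕ) := Primrec.dom_finite _
  exact Primrec.nat_add.comp
    (Primrec.nat_mul.comp (Primrec.fst.comp .snd) (Primrec.fst.comp .fst))
    (hdigit.comp (Primrec.snd.comp .snd))

theorem exists_primrec_test {β : ℝ} (h0 : β ≠ 0) (h : IsAlgebraic ℤ β) :
    ∃ T : List Bool → List Bool → Bool, Primrec₂ T ∧
      ∀ x y : List Bool, y.length = x.length → (T x y ↔ y ∈ eqClass β x) := by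
  obtain ⟨m, hdeg, hm, hmβ, hmin⟩ := exists_minimal_annihilator h
  obtain ⟨H, hH⟩ := exists_abs_coeff_le m
  obtain ⟨a, ha⟩ := Int.eq_ofNat_of_zero_le hm.le
  -- The difference of two remainders has coefficients at most `2 * (3 * H) ^ n`; the final `1`
  -- makes the bound strict.
  let N : List Bool → ℕ := fun x => H + 2 * (3 * H) ^ x.length + 1
  let F : List Bool → List Bool → ℕ := fun x y =>
    a ^ x.length * horner (N x) y % (m.eval (N x : ℤ)).natAbs
  have hN : Primrec N := Primrec.succ.comp (Primrec.nat_add.comp (.const H)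
    (Primrec.nat_mul.comp (.const 2) (primrec_pow.comp (.const _) Primrec.list_length)))
  have hF : Primrec₂ F := Primrec.nat_mod.comp
    (Primrec.nat_mul.comp (primrec_pow.comp (.const a) (Primrec.list_length.comp .fst))
      (primrec_horner.comp (hN.comp .fst) .snd))
    ((primrec_natAbs_eval m).comp (hN.comp .fst))
  refine ⟨fun x y => F x y == F x x,
    Primrec.beq.comp hF (hF.comp .fst .fst), fun x y hxy => ?_⟩
  have key := eval_dvd_iff_horner_eq hdeg hm hmβ hmin hH hxy (N := (N x : ℤ)) (by
    simp only [N]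
    push_cast
    linarith)
  have hcast (l : List Bool) : horner (N x : ℤ) l = (horner (N x) l : ℕ) :=
    (map_horner (Nat.castRingHom ℤ) (N x) l).symm
  have hmem : y ∈ eqClass β x ↔ horner β x = horner β y := by
    rw [horner_eq_pow_mul_value h0, horner_eq_pow_mul_value h0, hxy,
      mul_right_inj' (pow_ne_zero _ h0)]
    simp [eqClass, Equivalent, hxy]
  rw [hmem, ← key, beq_iff_eq, ha, hcast, hcast, ← Int.natAbs_dvd, mul_sub]
  change Nat.ModEq _ _ _ ↔ _
  rw [Nat.modEq_iff_dvd]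
  push_cast
  rfl

/-- The words of a given length, in decreasing lexicographic order. -/
def words (n : ℕ) : List (List Bool) :=
  n.rec [[]] fun _ L => L.map (List.cons true) ++ L.map (List.cons false)

theorem words_succ (n : ℕ) :
    words (n + 1) = (words n).map (List.cons true) ++ (words n).map (List.cons false) := rfl

theorem primrec_words : Primrec words := by
  refine Primrec.nat_rec₁ _ ?_
  have h (b : Bool) : Primrec fun p : ℕ × List (List Bool) => p.2.map (List.cons b) :=
    Primrec.list_map Primrec.snd (Primrec.list_cons.comp (.const b) Primrec.snd)
  exact Primrec.list_append.comp (h true) (h false)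

theorem mem_words {n : ℕ} {y : List Bool} : y ∈ words n ↔ y.length = n := by
  induction n generalizing y with
  | zero => simp [words]
  | succ n ih =>
    rcases y with _ | ⟨_ | _, y⟩ <;> simp [words_succ, ih]

theorem pairwise_words (n : ℕ) : (words n).Pairwise (· > ·) := by
  induction n with
  | zero => exact List.pairwise_singleton _ _
  | succ n ih =>
    rw [words_succ, List.pairwise_append, List.pairwise_map, List.pairwise_map]
    have h (b : Bool) : (words n).Pairwise fun y z => b :: y > b :: z :=
      ih.imp fun hyz => List.cons_lt_cons_iff.2 (.inr ⟨rfl, hyz⟩)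
    refine ⟨h true, h false, ?_⟩
    simp only [List.mem_map]
    rintro _ ⟨y, -, rfl⟩ _ ⟨z, -, rfl⟩
    exact List.cons_lt_cons_iff.2 (.inl rfl)

theorem computable_lexMaxRep {β : ℝ} (h0 : β ≠ 0) (h : IsAlgebraic ℤ β) :
    Computable (lexMaxRep β) := by
  obtain ⟨T, hT, hTβ⟩ := exists_primrec_test h0 h
  have hfilter : Primrec fun x : List Bool =>
      (words x.length).filterMap fun y => bif T x y then some y else none :=
    Primrec.listFilterMap (primrec_words.comp .list_length)
      (Primrec.cond hT (Primrec.option_some.comp Primrec.snd) (.const none))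
  -- The candidates come in decreasing order, so the first that passes the test is the largest. The
  -- default of `headI` never occurs, as `x` itself passes.
  refine ((Primrec.list_headI.comp hfilter).of_eq fun x => ?_).to_comp
  have hmem (y : List Bool) : y ∈ (words x.length).filter (T x) ↔ y ∈ eqClass β x := by
    rw [List.mem_filter, mem_words]
    exact ⟨fun hy => (hTβ x y hy.1).1 hy.2, fun hy => ⟨hy.1.symm, (hTβ x y hy.1.symm).2 hy⟩⟩
  have heq : ((words x.length).filterMap fun y => bif T x y then some y else none) =
      (words x.length).filter (T x) := by
    rw [← List.filterMap_eq_filter]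
    congr 1
    funext y
    cases hy : T x y <;> simp [Option.guard, hy]
  have hpair := (pairwise_words x.length).filter (T x)
  rw [heq]
  revert hmem hpair
  cases (words x.length).filter (T x) with
  | nil => exact fun hmem _ => absurd ((hmem x).2 (self_mem_eqClass β x)) List.not_mem_nil
  | cons y L =>
    intro hmem hpair
    refine (eq_lexMaxRep ((hmem y).1 List.mem_cons_self) fun z hz => ?_).symm
    rcases List.mem_cons.1 ((hmem z).2 hz) with rfl | hz'
    · exact le_rfl
    · exact le_of_lt ((List.pairwise_cons.1 hpair).1 z hz')

end BetaExpansion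

theorem mainTheorem5 (β : ℝ) (h1 : 1 < β) (h2 : β < 2) (halg : IsAlgebraic ℚ β) :
    Computable (BetaExpansion.lexMaxRep β) ∧
      (BetaExpansion.IsPisot β →
        BetaExpansion.ComputableInLinearTime (BetaExpansion.lexMaxRep β)) :=
  ⟨BetaExpansion.computable_lexMaxRep (by positivity)
      ((IsFractionRing.isAlgebraic_iff ℤ ℚ ℝ).2 halg),
    BetaExpansion.computableInLinearTime_lexMaxRep⟩
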